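/- Let $\alpha\in(0,1)$ and $T>0$. For an absolutely continuous $x:[0,T]\to\mathbb C$ let $${}^C\!D^\alpha x(t)=\frac1{\Gamma(1-\alpha)}\int_0^t (t-\tau)^{-\alpha}x'(\tau)\,d\tau,\qquad {}^L\!D^\alpha x(t)=\frac{{}^C\!D^\alpha x(t)}{{}^C\!D^\alpha t}=\frac{\Gamma(2-\alpha)}{t^{1-\alpha}}\,{}^C\!D^\alpha x(t)$$ be the Caputo and the L-fractional derivative, defined for almost every $t\in[0,T]$, and let $$\mathcal E_\alpha(s)=\sum_{n=0}^\infty \frac{s^n}{\Gamma(2-\alpha)^n\prod_{j=1}^n \frac{\Gamma(j+1)}{\Gamma(j+1-\alpha)}},\qquad s\in\mathbb C,$$ with ordinary $k$-th derivative $\mathcal E_\alpha^{(k)}$. For $\lambda\in\mathbb C$ and $n\ge 1$ put $\mathcal B_{\lambda,n}=\{t^k\mathcal E_\alpha^{(k)}(\lambda t): k=0,\dots,n-1\}$. Let $\lambda_1,\dots,\lambda_r\in\mathbb C$ be distinct, let $n_1,\dots,n_r\ge 1$ and $J\ge 0$ be integers, and let $\beta_0,\dots,\beta_J,\mu\in\mathbb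 C$. Let $x:[0,T]\to\mathbb C$ be a solution of $$({}^L\!D^\alpha-\lambda_1)^{n_1}\circ\cdots\circ({}^L\!D^\alpha-\lambda_r)^{n_r}x(t)=\sum_{j=0}^J\beta_j t^j\mathcal E_\alpha^{(j)}(\mu t)\qquad\text{on }[0,T],$$ in the following sense: when the factors ${}^L\!D^\alpha-\lambda_l$ are applied one after another, each function to which a factor is applied is absolutely continuous on $[0,T]$ (after modification on a null set, for the functions produced by the earlier factors), and the equation holds almost everywhere. (This includes all solutions given by power series on $[0,T]$.) 1. If $\mu\ne\lambda_l$ for every $l=1,\dots,r$, then on $[0,T]$ $$x\in\Big\langle \bigcup_{l=1}^r\mathcal B_{\lambda_l,n_l}\cup\{t^j\mathcal E_\alpha^{(j)}(\mu t): j=0,\dots,J\}\Big\rangle .$$ 2. If $\mu=\lambda_{l_0}$ for some $l_0\in\{1,\dots,r\}$, then on $[0,T]$ $$x\in\Big\langle \bigcup_{l\ne l_0}\mathcal B_{\lambda_l,n_l}\cup\{t^k\mathcal E_\alpha^{(k)}(\lambda_{l_0}t): k=0,\dots,J+n_{l_0}\}\Big\rangle .$$ Here $\langle\cdot\rangle$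 denotes the linear span over $\mathbb C$. -/

import Mathlib

open MeasureTheory

noncomputable section

namespace LFrac

/-- Riemann-Liouville fractional integral of order `a` with base point `0`:
`(1 / Γ(a)) ∫₀ᵗ (t - τ) ^ (a - 1) x(τ) dτ`. -/
def rlIntegral (a : ℝ) (x : ℝ → ℂ) (t : ℝ) : ℂ :=
  ((1 / Real.Gamma a : ℝ) : ℂ) * ∫ τ in (0 : ℝ)..t, (((t - τ) ^ (a - 1) : ℝ) : ℂ) * x τ

/-- Caputo fractional derivative of order `α ∈ (0, 1)`: the Riemann-Liouville integral of
order `1 - α` of the ordinary derivative. It is used for absolutely continuous `x` only, and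
is then meaningful for almost every `t`. -/
def caputoDeriv (α : ℝ) (x : ℝ → ℂ) (t : ℝ) : ℂ :=
  rlIntegral (1 - α) (deriv x) t

/-- L-fractional derivative of order `α`: the Caputo derivative of `x` divided by the Caputo
derivative of the identity function. -/
def lDeriv (α : ℝ) (x : ℝ → ℂ) (t : ℝ) : ℂ :=
  caputoDeriv α x t / caputoDeriv α (fun s : ℝ => (s : ℂ)) t

/-- `y = (ᴸD^α - c) x` on `[0, T]`: the function `x` is absolutely continuous on `[0, T]`, and
the equality holds almost everywhere on `[0, T]`. -/
def LShift (α T : ℝ) (c : ℂ) (x y : ℝ → ℂ) : Prop :=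
  AbsolutelyContinuousOnInterval x 0 T ∧
    ∀ᵐ t ∂(volume.restrict (Set.Icc 0 T)), lDeriv α x t - c * x t = y t

/-- `y = (ᴸD^α - c)^k x` on `[0, T]`, the `k`-fold composition. -/
def LShiftPow (α T : ℝ) (c : ℂ) : ℕ → (ℝ → ℂ) → (ℝ → ℂ) → Prop
  | 0 => fun x y => y = x
  | k + 1 => fun x y => ∃ z, LShiftPow α T c k x z ∧ LShift α T c z y

/-- `y = (ᴸD^α - c₁)^k₁ ∘ ⋯ ∘ (ᴸD^α - c_r)^k_r x` on `[0, T]` for the list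
`[(c₁, k₁), …, (c_r, k_r)]`. The last factor of the list acts first. Every function to which
`ᴸD^α` is applied is absolutely continuous on `[0, T]`. -/
def LSeq (α T : ℝ) : List (ℂ × ℕ) → (ℝ → ℂ) → (ℝ → ℂ) → Prop
  | [] => fun x y => y = x
  | (c, k) :: L => fun x y => ∃ z, LSeq α T L x z ∧ LShiftPow α T c k z y

/-- The Mittag-Leffler-type function
`𝓔_α(s) = ∑ₙ sⁿ / (Γ(2-α)ⁿ ∏_{j=1}^n Γ(j+1) / Γ(j+1-α))`. -/
def mittagLefflerL (α : ℝ) (s : ℂ) : ℂ :=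
  ∑' n : ℕ, s ^ n / ((Real.Gamma (2 - α) ^ n *
    ∏ j ∈ Finset.Icc 1 n, Real.Gamma (j + 1) / Real.Gamma (j + 1 - α) : ℝ) : ℂ)

/-- The function `t ↦ t ^ k 𝓔_α^{(k)}(c t)`. -/
def mlTerm (α : ℝ) (c : ℂ) (k : ℕ) (t : ℝ) : ℂ :=
  (t : ℂ) ^ k * iteratedDeriv k (mittagLefflerL α) (c * t)

/-- The block `𝓑_{c,n} = {t ^ k 𝓔_α^{(k)}(c t) : k = 0, …, n - 1}`. -/
def block (α : ℝ) (c : ℂ) (n : ℕ) : Set (ℝ → ℂ) :=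
  {f | ∃ k < n, f = mlTerm α c k}

end LFrac

end

/-! Write `D` for the L-fractional derivative and `e_{d,k}(t) = t^k 𝓔^{(k)}(d t)`. These functions
form Jordan chains: `(D - d) e_{d,k} = k e_{d,k-1}`, and `e_{d,0}` takes the value 1 at 0. So each
factor `D - c` can be inverted within their spans, and the kernel of `D - c` is spanned by
`e_{c,0}`.

Inverting one factor costs at most one more chain element at `c`. If `d = c`, then `e_{d,k+1}/(k+1)`
is a preimage of `e_{d,k}`; if `d ≠ c`, a preimage already lies in the span of `e_{d,0}, …, e_{d,k}`
(`exists_isLSol_mlTerm`). Peeling off all factors turns the multiplicity `J + 1` at `μ` into that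
plus `n_l` at each `λ_l`; the two cases say whether these counts meet.

Uniqueness is proved for an integrated equation. Abel's identity turns `(D - c) x = y` into the
Volterra equation `x = x(0) + I(c x + y)`, with `I` the operator `lIntegral`
(`LShift.eq_add_lIntegral`). For continuous data it is linear and has at most one solution with
given `x(0)`, by a singular Gronwall argument (`IsLSol.eq_zero`). The chain relation is also checked
in this form, by integrating power series term by term. -/

namespace LFrac

/-! ### Beta integrals and Abel's identity -/

open Set in
theorem integral_rpow_mul_rpow {p q : ℝ} (hp : 0 < p) (hq : 0 < q) {τ t : ℝ} (h : τ < t) :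
    ∫ s in τ..t, (t - s) ^ (p - 1) * (s - τ) ^ (q - 1) =
      (t - τ) ^ (p + q - 1) * (Real.Gamma p * Real.Gamma q / Real.Gamma (p + q)) := by
  have hd : 0 < t - τ := sub_pos.2 h
  have key := Complex.betaIntegral_scaled (q : ℂ) (p : ℂ) hd
  rw [Complex.betaIntegral_eq_Gamma_mul_div _ _ (by simpa) (by simpa)] at key
  have h1 := intervalIntegral.integral_comp_sub_right
    (fun s => (t - τ - s) ^ (p - 1) * s ^ (q - 1)) (a := τ) (b := t) τ
  have h2 : ∫ s in τ..t, (t - s) ^ (p - 1) * (s - τ) ^ (q - 1) =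
      ∫ s in (0 : ℝ)..(t - τ), (t - τ - s) ^ (p - 1) * s ^ (q - 1) := by
    rw [sub_self] at h1
    rw [← h1]
    congr 1
    ext s
    congr 2
    ring
  rw [h2]
  apply Complex.ofReal_injective
  rw [← intervalIntegral.integral_ofReal]
  have h3 : ∫ s in (0 : ℝ)..(t - τ), (((t - τ - s) ^ (p - 1) * s ^ (q - 1) : ℝ) : ℂ) =
      ∫ s in (0 : ℝ)..(t - τ), (s : ℂ) ^ ((q : ℂ) - 1) *
        (((t - τ : ℝ) : ℂ) - s) ^ ((p : ℂ) - 1) := by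
    apply intervalIntegral.integral_congr
    intro s hs
    rw [uIcc_of_le hd.le] at hs
    have e1 : (0 : ℝ) ≤ t - τ - s := by linarith [hs.2]
    simp only [Complex.ofReal_mul, Complex.ofReal_cpow e1, Complex.ofReal_cpow hs.1]
    push_cast
    ring
  rw [h3, key]
  simp only [← Complex.ofReal_add, Complex.Gamma_ofReal]
  push_cast [Complex.ofReal_cpow hd.le]
  rw [add_comm (q : ℂ) p, add_comm q p, mul_comm (Complex.ofReal (Real.Gamma q))]

theorem intervalIntegrable_rpow_mul_rpow {p q : ℝ} (hp : 0 < p) (hq : 0 < q) {τ t : ℝ}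
    (h : τ < t) :
    IntervalIntegrable (fun s => (t - s) ^ (p - 1) * (s - τ) ^ (q - 1)) volume τ t := by
  -- A non-integrable function has integral 0 by convention, whereas the Beta value is positive.
  apply intervalIntegral.intervalIntegrable_of_integral_ne_zero
  rw [integral_rpow_mul_rpow hp hq h]
  have := Real.Gamma_pos_of_pos hp
  have := Real.Gamma_pos_of_pos hq
  have := Real.Gamma_pos_of_pos (add_pos hp hq)
  have := Real.rpow_pos_of_pos (sub_pos.2 h) (p + q - 1)
  positivity

/-- Abel's identity: Riemann-Liouville integrals of orders `α` and `1 - α` compose to the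
ordinary integral. -/
theorem rlIntegral_rlIntegral_one_sub {α : ℝ} (hα0 : 0 < α) (hα1 : α < 1) {g : ℝ → ℂ} {t : ℝ}
    (ht : 0 < t) (hg : IntervalIntegrable g volume 0 t) :
    rlIntegral α (rlIntegral (1 - α) g) t = ∫ τ in (0 : ℝ)..t, g τ := by
  have hG1 := Real.Gamma_pos_of_pos hα0
  have hG2 := Real.Gamma_pos_of_pos (sub_pos.2 hα1)
  set B : ℝ := Real.Gamma α * Real.Gamma (1 - α) with hB
  -- Extending the kernel by zero off the triangle `τ < s` lets Fubini run on a square.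
  set k : ℝ → ℝ → ℝ := fun s τ =>
    if τ < s then (t - s) ^ (α - 1) * (s - τ) ^ (1 - α - 1) else 0 with hk
  set ν : Measure ℝ := volume.restrict (Set.Ioo 0 t) with hν
  have hkm : Measurable (Function.uncurry k) := by
    apply Measurable.ite
    · exact measurableSet_lt measurable_snd measurable_fst
    · fun_prop
    · fun_prop
  have hk0 : ∀ τ ∈ Set.Ioo 0 t, ∀ s, s ∈ Set.Ioo 0 t → 0 ≤ k s τ := by
    intro τ hτ s hs
    simp only [hk]
    split_ifs with h
    · exact mul_nonneg (Real.rpow_nonneg (by linarith [hs.2]) _)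
        (Real.rpow_nonneg (by linarith) _)
    · exact le_rfl
  have hind : ∀ τ ∈ Set.Ioo 0 t, ∀ s, (Set.Ioo 0 t).indicator (fun s => k s τ) s =
      (Set.Ioo τ t).indicator (fun s => (t - s) ^ (α - 1) * (s - τ) ^ (1 - α - 1)) s := by
    intro τ hτ s
    simp only [hk, Set.indicator_apply, Set.mem_Ioo]
    have := hτ.1
    split_ifs <;> first | rfl | (exfalso; grind)
  have hint : ∀ τ ∈ Set.Ioo 0 t, Integrable (fun s => k s τ) ν := by
    intro τ hτ
    rw [hν, ← IntegrableOn, ← integrable_indicator_iff measurableSet_Ioo, funext (hind τ hτ),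
      integrable_indicator_iff measurableSet_Ioo, ← intervalIntegrable_iff_integrableOn_Ioo_of_le
      hτ.2.le]
    exact intervalIntegrable_rpow_mul_rpow hα0 (sub_pos.2 hα1) hτ.2
  have hval : ∀ τ ∈ Set.Ioo 0 t, ∫ s, k s τ ∂ν = B := by
    intro τ hτ
    rw [hν, ← integral_indicator measurableSet_Ioo, funext (hind τ hτ),
      integral_indicator measurableSet_Ioo, ← integral_Ioc_eq_integral_Ioo,
      ← intervalIntegral.integral_of_le hτ.2.le,
      integral_rpow_mul_rpow hα0 (sub_pos.2 hα1) hτ.2]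
    simp [hB]
  have hgν : Integrable g ν := (intervalIntegrable_iff_integrableOn_Ioo_of_le ht.le).1 hg
  have hae : ∀ᵐ τ ∂ν, τ ∈ Set.Ioo 0 t := ae_restrict_mem measurableSet_Ioo
  -- The orders add up to 1, so the `s`-integral of the kernel is `B` for every `τ`; integrability
  -- of `g` therefore suffices.
  have hI : Integrable (Function.uncurry fun s τ => ((k s τ : ℝ) : ℂ) * g τ) (ν.prod ν) := by
    rw [integrable_prod_iff']
    · refine ⟨?_, ?_⟩
      · filter_upwards [hae] with τ hτ
        exact Integrable.mul_const (Integrable.ofReal (𝕜 := ℂ) (hint τ hτ)) (g τ)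
      · refine (hgν.norm.const_mul B).congr ?_
        filter_upwards [hae] with τ hτ
        simp only [Function.uncurry, norm_mul]
        rw [integral_mul_const, ← hval τ hτ]
        congr 1
        apply integral_congr_ae
        filter_upwards [hae] with s hs
        rw [Complex.norm_real, Real.norm_of_nonneg (hk0 τ hτ s hs)]
    · exact (Complex.measurable_ofReal.comp hkm).aestronglyMeasurable.mul hgν.1.comp_snd
  have hswap := integral_integral_swap hI
  have hR : ∫ τ, ∫ s, ((k s τ : ℝ) : ℂ) * g τ ∂ν ∂ν = (B : ℂ) * ∫ τ in (0 : ℝ)..t, g τ := by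
    rw [intervalIntegral.integral_of_le ht.le, integral_Ioc_eq_integral_Ioo, ← integral_const_mul]
    apply integral_congr_ae
    filter_upwards [hae] with τ hτ
    rw [integral_mul_const, integral_complex_ofReal, hval τ hτ]
  have hLe : ∫ s, ∫ τ, ((k s τ : ℝ) : ℂ) * g τ ∂ν ∂ν = (Real.Gamma (1 - α) : ℂ) *
      ∫ s in (0 : ℝ)..t, (((t - s) ^ (α - 1) : ℝ) : ℂ) * rlIntegral (1 - α) g s := by
    rw [intervalIntegral.integral_of_le ht.le, integral_Ioc_eq_integral_Ioo, ← integral_const_mul]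
    apply integral_congr_ae
    filter_upwards [hae] with s hs
    have h1 : ∫ τ, ((k s τ : ℝ) : ℂ) * g τ ∂ν = (((t - s) ^ (α - 1) : ℝ) : ℂ) *
        ∫ τ in (0 : ℝ)..s, (((s - τ) ^ (1 - α - 1) : ℝ) : ℂ) * g τ := by
      rw [intervalIntegral.integral_of_le hs.1.le, integral_Ioc_eq_integral_Ioo,
        ← integral_const_mul, hν, ← integral_indicator measurableSet_Ioo,
        ← integral_indicator measurableSet_Ioo]
      congr 1
      ext τ
      simp only [hk, Set.indicator_apply, Set.mem_Ioo]
      have := hs.2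
      split_ifs <;> first | (exfalso; grind) | (push_cast; ring)
    rw [h1, rlIntegral]
    have : (Real.Gamma (1 - α) : ℂ) ≠ 0 := by exact_mod_cast hG2.ne'
    push_cast
    field_simp
  rw [hR, hLe] at hswap
  rw [rlIntegral]
  have h1 : (Real.Gamma (1 - α) : ℂ) ≠ 0 := by exact_mod_cast hG2.ne'
  have h2 : (Real.Gamma α : ℂ) ≠ 0 := by exact_mod_cast hG1.ne'
  apply mul_left_cancel₀ h1
  apply mul_left_cancel₀ h2
  rw [hB] at hswap
  push_cast at hswap ⊢
  rw [mul_left_comm (Complex.ofReal (Real.Gamma (1 - α))), hswap]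
  field_simp

/-! ### Absolutely continuous complex-valued functions, via real and imaginary parts -/

theorem _root_.AbsolutelyContinuousOnInterval.complex_re {x : ℝ → ℂ} {a b : ℝ}
    (hx : AbsolutelyContinuousOnInterval x a b) :
    AbsolutelyContinuousOnInterval (fun t => (x t).re) a b := by
  refine squeeze_zero (fun t => Finset.sum_nonneg fun i hi => by positivity) (fun t => ?_) hx
  gcongr with i hi
  rw [Real.dist_eq, Complex.dist_eq, ← Complex.sub_re]
  exact Complex.abs_re_le_norm _

theorem _root_.AbsolutelyContinuousOnInterval.complex_im {x : ℝ → ℂ} {a b : ℝ}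
    (hx : AbsolutelyContinuousOnInterval x a b) :
    AbsolutelyContinuousOnInterval (fun t => (x t).im) a b := by
  refine squeeze_zero (fun t => Finset.sum_nonneg fun i hi => by positivity) (fun t => ?_) hx
  gcongr with i hi
  rw [Real.dist_eq, Complex.dist_eq, ← Complex.sub_im]
  exact Complex.abs_im_le_norm _

theorem _root_.AbsolutelyContinuousOnInterval.ae_deriv_complex {x : ℝ → ℂ} {a b : ℝ}
    (hx : AbsolutelyContinuousOnInterval x a b) :
    ∀ᵐ t, t ∈ Set.uIcc a b → deriv x t =
      ((deriv (fun t => (x t).re) t : ℝ) : ℂ) + ((deriv (fun t => (x t).im) t : ℝ) : ℂ) *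
        Complex.I := by
  filter_upwards [hx.complex_re.ae_differentiableAt, hx.complex_im.ae_differentiableAt]
    with t h1 h2 ht
  have h := ((h1 ht).hasDerivAt.ofReal_comp).add
    (((h2 ht).hasDerivAt.ofReal_comp).mul_const Complex.I)
  rw [← h.deriv]
  congr 1
  ext s
  simp

theorem _root_.IntervalIntegrable.complex_ofReal {f : ℝ → ℝ} {a b : ℝ}
    (hf : IntervalIntegrable f volume a b) :
    IntervalIntegrable (fun t => (f t : ℂ)) volume a b :=
  ⟨Integrable.ofReal (𝕜 := ℂ) hf.1, Integrable.ofReal (𝕜 := ℂ) hf.2⟩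

theorem _root_.AbsolutelyContinuousOnInterval.intervalIntegrable_deriv_complex {x : ℝ → ℂ}
    {a b : ℝ} (hx : AbsolutelyContinuousOnInterval x a b) :
    IntervalIntegrable (deriv x) volume a b := by
  have h1 : IntervalIntegrable (fun t => ((deriv (fun t => (x t).re) t : ℝ) : ℂ) +
      ((deriv (fun t => (x t).im) t : ℝ) : ℂ) * Complex.I) volume a b :=
    (hx.complex_re.intervalIntegrable_deriv.complex_ofReal).add
      (hx.complex_im.intervalIntegrable_deriv.complex_ofReal.mul_const _)
  refine h1.congr_ae ?_
  rw [Filter.EventuallyEq, ae_restrict_iff' measurableSet_uIoc]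
  filter_upwards [hx.ae_deriv_complex] with t ht h
  exact (ht (Set.uIoc_subset_uIcc h)).symm

theorem _root_.AbsolutelyContinuousOnInterval.integral_deriv_complex {x : ℝ → ℂ} {a b : ℝ}
    (hx : AbsolutelyContinuousOnInterval x a b) :
    ∫ t in a..b, deriv x t = x b - x a := by
  have h : ∫ t in a..b, deriv x t = ∫ t in a..b, (((deriv (fun t => (x t).re) t : ℝ) : ℂ) +
      ((deriv (fun t => (x t).im) t : ℝ) : ℂ) * Complex.I) := by
    apply intervalIntegral.integral_congr_ae
    filter_upwards [hx.ae_deriv_complex] with t ht h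
    exact ht (Set.uIoc_subset_uIcc h)
  rw [h, intervalIntegral.integral_add hx.complex_re.intervalIntegrable_deriv.complex_ofReal
    (hx.complex_im.intervalIntegrable_deriv.complex_ofReal.mul_const _),
    intervalIntegral.integral_mul_const, intervalIntegral.integral_ofReal,
    intervalIntegral.integral_ofReal, hx.complex_re.integral_deriv_eq_sub,
    hx.complex_im.integral_deriv_eq_sub]
  apply Complex.ext <;> simp

/-! ### The L-fractional integral and the Volterra equation -/

/-- Right inverse of the L-fractional derivative: the Riemann-Liouville integral of order `α`
with weight `s ^ (1 - α) / Γ(2 - α)`. -/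
noncomputable def lIntegral (α : ℝ) (g : ℝ → ℂ) (t : ℝ) : ℂ :=
  rlIntegral α (fun s => ((s ^ (1 - α) / Real.Gamma (2 - α) : ℝ) : ℂ) * g s) t

theorem caputoDeriv_id {α : ℝ} (hα1 : α < 1) {t : ℝ} (ht : 0 < t) :
    caputoDeriv α (fun s : ℝ => (s : ℂ)) t = ((t ^ (1 - α) / Real.Gamma (2 - α) : ℝ) : ℂ) := by
  have hd : deriv (fun s : ℝ => (s : ℂ)) = fun _ => 1 := by
    ext s
    exact (hasDerivAt_id s).ofReal_comp.deriv
  have h := integral_rpow_mul_rpow (sub_pos.2 hα1) one_pos ht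
  have hG := Real.Gamma_pos_of_pos (sub_pos.2 hα1)
  simp only [sub_self, Real.rpow_zero, mul_one, Real.Gamma_one, sub_zero, add_sub_cancel_right] at h
  rw [caputoDeriv, rlIntegral, hd]
  simp only [mul_one]
  rw [intervalIntegral.integral_ofReal, h, ← Complex.ofReal_mul]
  congr 1
  rw [show 1 - α + 1 = 2 - α by ring]
  field_simp

/-- The weight in `lIntegral` is the Caputo derivative of the identity, so it cancels the
denominator of `lDeriv`, and Abel's identity leaves `∫ x'`. Integration ignores null sets, so an
almost everywhere equation yields one at every `t`. -/
theorem LShift.eq_add_lIntegral {α T : ℝ} (hα0 : 0 < α) (hα1 : α < 1) {c : ℂ} {x y : ℝ → ℂ}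
    (h : LShift α T c x y) {t : ℝ} (ht : t ∈ Set.Icc 0 T) :
    x t = x 0 + lIntegral α (fun s => c * x s + y s) t := by
  rcases ht.1.eq_or_lt with h0 | h0
  · rw [← h0]
    simp [lIntegral, rlIntegral]
  have hac : AbsolutelyContinuousOnInterval x 0 t := h.1.mono (by
    rw [Set.uIcc_of_le ht.1, Set.uIcc_of_le (ht.1.trans ht.2)]
    exact Set.Icc_subset_Icc_right ht.2)
  have h1 := rlIntegral_rlIntegral_one_sub hα0 hα1 h0 hac.intervalIntegrable_deriv_complex
  rw [hac.integral_deriv_complex] at h1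
  rw [← sub_eq_iff_eq_add', ← h1, lIntegral, rlIntegral, rlIntegral]
  congr 1
  apply intervalIntegral.integral_congr_ae
  have h2 := h.2
  rw [ae_restrict_iff' measurableSet_Icc] at h2
  filter_upwards [h2] with s hs hst
  rw [Set.uIoc_of_le ht.1] at hst
  have hs' := hs ⟨hst.1.le, hst.2.trans ht.2⟩
  congr 1
  rw [← hs', add_sub_cancel, lDeriv, caputoDeriv_id hα1 hst.1, caputoDeriv, mul_div_cancel₀]
  have := Real.Gamma_pos_of_pos (show 0 < 2 - α by linarith)
  have := Real.rpow_pos_of_pos hst.1 (1 - α)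
  exact_mod_cast (show s ^ (1 - α) / Real.Gamma (2 - α) ≠ 0 by positivity)

/-! ### Coefficients of the Mittag-Leffler-type series -/

/-- The value of `lIntegral` on `s ^ n` is `lRatio n * t ^ (n + 1)`. -/
noncomputable def lRatio (α : ℝ) (n : ℕ) : ℝ :=
  Real.Gamma (n + 2 - α) / (Real.Gamma (2 - α) * Real.Gamma (n + 2))

/-- The power series coefficients of `mittagLefflerL`. -/
noncomputable def mlCoeff (α : ℝ) (n : ℕ) : ℝ :=
  (Real.Gamma (2 - α) ^ n *
    ∏ j ∈ Finset.Icc 1 n, Real.Gamma (j + 1) / Real.Gamma (j + 1 - α))⁻¹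

theorem lRatio_pos {α : ℝ} (hα1 : α < 1) (n : ℕ) : 0 < lRatio α n := by
  have := Real.Gamma_pos_of_pos (show 0 < n + 2 - α by
    have : (0 : ℝ) ≤ n := n.cast_nonneg
    linarith)
  have := Real.Gamma_pos_of_pos (show 0 < 2 - α by linarith)
  have := Real.Gamma_pos_of_pos (show 0 < (n : ℝ) + 2 by positivity)
  unfold lRatio
  positivity

theorem mlCoeff_zero (α : ℝ) : mlCoeff α 0 = 1 := by simp [mlCoeff]

theorem mlCoeff_succ (α : ℝ) (n : ℕ) : mlCoeff α (n + 1) = lRatio α n * mlCoeff α n := by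
  rw [mlCoeff, mlCoeff, lRatio, Finset.prod_Icc_succ_top (by omega), pow_succ]
  push_cast
  rw [show (n : ℝ) + 1 + 1 = n + 2 by ring, mul_mul_mul_comm, mul_inv, mul_comm]
  congr 1
  rw [mul_inv, inv_div, div_mul_eq_div_div, div_eq_mul_inv, div_eq_mul_inv, div_eq_mul_inv]
  ring

theorem mlCoeff_pos {α : ℝ} (hα1 : α < 1) (n : ℕ) : 0 < mlCoeff α n := by
  induction n with
  | zero => simp [mlCoeff_zero]
  | succ n ih => rw [mlCoeff_succ]; exact mul_pos (lRatio_pos hα1 n) ih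

/-- Log-convexity of Γ at `n + 2 - α = α (n + 1) + (1 - α) (n + 2)`. The decay makes the series
entire by the ratio test. -/
theorem lRatio_le {α : ℝ} (hα0 : 0 < α) (hα1 : α < 1) (n : ℕ) :
    lRatio α n ≤ (Real.Gamma (2 - α))⁻¹ * ((n : ℝ) + 1) ^ (-α) := by
  have hn : (0 : ℝ) < n + 1 := by positivity
  have h := Real.Gamma_mul_add_mul_le_rpow_Gamma_mul_rpow_Gamma (s := n + 1) (t := n + 2) hn
    (by positivity) hα0 (sub_pos.2 hα1) (by ring)
  have hG := Real.Gamma_pos_of_pos hn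
  have hG2 := Real.Gamma_pos_of_pos (show 0 < (n : ℝ) + 2 by positivity)
  have hG3 := Real.Gamma_pos_of_pos (show 0 < 2 - α by linarith)
  have hrec : Real.Gamma ((n : ℝ) + 2) = (n + 1) * Real.Gamma (n + 1) := by
    rw [← Real.Gamma_add_one hn.ne']
    congr 1
    ring
  have h2 : Real.Gamma ((n : ℝ) + 1) ^ α * Real.Gamma ((n : ℝ) + 2) ^ (1 - α) =
      Real.Gamma (n + 2) * ((n : ℝ) + 1) ^ (-α) := by
    have : Real.Gamma ((n : ℝ) + 1) = Real.Gamma (n + 2) / (n + 1) := by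
      rw [hrec]; field_simp
    rw [this, Real.div_rpow hG2.le hn.le, Real.rpow_neg hn.le, div_mul_eq_mul_div,
      ← Real.rpow_add hG2, add_sub_cancel, Real.rpow_one, div_eq_mul_inv]
  rw [h2, show α * ((n : ℝ) + 1) + (1 - α) * (n + 2) = n + 2 - α by ring] at h
  rw [lRatio, div_le_iff₀ (by positivity)]
  refine h.trans_eq ?_
  field_simp

theorem lRatio_le_const {α : ℝ} (hα0 : 0 < α) (hα1 : α < 1) (n : ℕ) :
    lRatio α n ≤ (Real.Gamma (2 - α))⁻¹ := by
  have hG3 := Real.Gamma_pos_of_pos (show 0 < 2 - α by linarith)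
  refine (lRatio_le hα0 hα1 n).trans (mul_le_of_le_one_right (by positivity) ?_)
  exact Real.rpow_le_one_of_one_le_of_nonpos (by simp) (by linarith)

theorem tendsto_lRatio {α : ℝ} (hα0 : 0 < α) (hα1 : α < 1) :
    Filter.Tendsto (lRatio α) Filter.atTop (nhds 0) := by
  refine squeeze_zero (fun n => (lRatio_pos hα1 n).le) (lRatio_le hα0 hα1) ?_
  rw [← mul_zero (Real.Gamma (2 - α))⁻¹]
  apply Filter.Tendsto.const_mul
  exact (tendsto_rpow_neg_atTop hα0).comp
    (Filter.tendsto_atTop_add_const_right _ _ tendsto_natCast_atTop_atTop)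

/-! ### Entire power series and termwise differentiation -/

/-- The power series with coefficients `b` converges absolutely everywhere. -/
def EntireCoeff (b : ℕ → ℂ) : Prop := ∀ R : ℝ, 0 < R → Summable fun n => ‖b n‖ * R ^ n

theorem EntireCoeff.summable_norm {b : ℕ → ℂ} (hb : EntireCoeff b) (z : ℂ) :
    Summable fun n => ‖b n * z ^ n‖ := by
  refine Summable.of_nonneg_of_le (fun n => norm_nonneg _) (fun n => ?_)
    (hb (‖z‖ + 1) (by positivity))
  rw [norm_mul, norm_pow]
  gcongr
  linarith

theorem entireCoeff_mlCoeff {α : ℝ} (hα0 : 0 < α) (hα1 : α < 1) :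
    EntireCoeff fun n => (mlCoeff α n : ℂ) := by
  intro R hR
  have hp : ∀ n, 0 < ‖(mlCoeff α n : ℂ)‖ * R ^ n := fun n => by
    have := mlCoeff_pos hα1 n
    rw [Complex.norm_real, Real.norm_of_nonneg this.le]
    positivity
  refine summable_of_ratio_test_tendsto_lt_one zero_lt_one
    (Filter.Eventually.of_forall fun n => (hp n).ne') ?_
  have h := (tendsto_lRatio hα0 hα1).mul_const R
  rw [zero_mul] at h
  refine h.congr fun n => ?_
  rw [Real.norm_of_nonneg (hp _).le, Real.norm_of_nonneg (hp _).le, eq_div_iff (hp n).ne',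
    Complex.norm_real, Complex.norm_real, Real.norm_of_nonneg (mlCoeff_pos hα1 _).le,
    Real.norm_of_nonneg (mlCoeff_pos hα1 _).le, mlCoeff_succ]
  ring

/-- Coefficients of the derivative of a power series. -/
def derivCoeff (b : ℕ → ℂ) (n : ℕ) : ℂ := (n + 1) * b (n + 1)

theorem EntireCoeff.derivCoeff {b : ℕ → ℂ} (hb : EntireCoeff b) :
    EntireCoeff (derivCoeff b) := by
  intro R hR
  -- Doubling the radius absorbs the factor `n + 1 ≤ 2 ^ (n + 1)`.
  have h := ((summable_nat_add_iff 1).2 (hb (2 * R) (by positivity))).mul_left R⁻¹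
  refine Summable.of_nonneg_of_le (fun n => by positivity) (fun n => ?_) h
  have h2 : ((n : ℝ) + 1) ≤ 2 ^ (n + 1) := by
    have := Nat.lt_two_pow_self (n := n + 1)
    exact_mod_cast this.le
  have h3 : ‖LFrac.derivCoeff b n‖ = ((n : ℝ) + 1) * ‖b (n + 1)‖ := by
    rw [LFrac.derivCoeff, norm_mul]
    congr 1
    exact_mod_cast Complex.norm_natCast (n + 1)
  rw [h3]
  calc ((n : ℝ) + 1) * ‖b (n + 1)‖ * R ^ n ≤ 2 ^ (n + 1) * ‖b (n + 1)‖ * R ^ n := by gcongr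
    _ = R⁻¹ * (‖b (n + 1)‖ * (2 * R) ^ (n + 1)) := by
      rw [mul_pow, pow_succ R]
      field_simp

theorem EntireCoeff.hasDerivAt {b : ℕ → ℂ} (hb : EntireCoeff b) (z : ℂ) :
    HasDerivAt (fun w => ∑' n, b n * w ^ n) (∑' n, LFrac.derivCoeff b n * z ^ n) z := by
  set R : ℝ := ‖z‖ + 1 with hR
  have hRpos : 0 < R := by positivity
  have hu : Summable fun n : ℕ => ‖b n‖ * (n * R ^ (n - 1)) := by
    rw [← summable_nat_add_iff 1]
    refine (hb.derivCoeff R hRpos).congr fun n => ?_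
    rw [LFrac.derivCoeff, norm_mul]
    have : ‖(n : ℂ) + 1‖ = (n : ℝ) + 1 := by exact_mod_cast Complex.norm_natCast (n + 1)
    rw [this]
    push_cast
    ring
  have h := hasDerivAt_tsum_of_isPreconnected (g := fun n w => b n * w ^ n)
    (g' := fun n w => b n * (n * w ^ (n - 1))) hu (Metric.isOpen_ball (x := (0 : ℂ)) (ε := R))
    (convex_ball _ _).isPreconnected (fun n y _ => (hasDerivAt_pow n y).const_mul _)
    (fun n y hy => by
      rw [mem_ball_zero_iff] at hy
      rw [norm_mul, norm_mul, norm_pow, Complex.norm_natCast]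
      gcongr) (y₀ := 0) (Metric.mem_ball_self hRpos) (hb.summable_norm 0).of_norm
    (y := z) (by rw [mem_ball_zero_iff, hR]; linarith)
  have hs : Summable fun n : ℕ => b n * (n * z ^ (n - 1)) := by
    refine Summable.of_norm_bounded hu fun n => ?_
    rw [norm_mul, norm_mul, norm_pow, Complex.norm_natCast]
    gcongr
    rw [hR]; linarith
  have he : ∑' n, LFrac.derivCoeff b n * z ^ n = ∑' n : ℕ, b n * (n * z ^ (n - 1)) := by
    rw [hs.tsum_eq_zero_add]
    simp only [Nat.cast_zero, zero_mul, mul_zero, zero_add]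
    refine tsum_congr fun n => ?_
    rw [LFrac.derivCoeff]
    push_cast
    ring
  rw [he]
  exact h

theorem EntireCoeff.iterate {b : ℕ → ℂ} (hb : EntireCoeff b) (k : ℕ) :
    EntireCoeff (LFrac.derivCoeff^[k] b) := by
  induction k with
  | zero => exact hb
  | succ k ih => rw [Function.iterate_succ_apply']; exact ih.derivCoeff

theorem EntireCoeff.iteratedDeriv {b : ℕ → ℂ} (hb : EntireCoeff b) (k : ℕ) :
    iteratedDeriv k (fun w => ∑' n, b n * w ^ n) =
      fun z => ∑' n, (LFrac.derivCoeff^[k] b) n * z ^ n := by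
  induction k with
  | zero => simp
  | succ k ih =>
    rw [iteratedDeriv_succ, ih]
    ext z
    rw [((hb.iterate k).hasDerivAt z).deriv, Function.iterate_succ_apply']

theorem iterate_derivCoeff (b : ℕ → ℂ) (k n : ℕ) :
    (derivCoeff^[k] b) n = ((n + k).descFactorial k : ℂ) * b (n + k) := by
  induction k generalizing n with
  | zero => simp
  | succ k ih =>
    rw [Function.iterate_succ_apply', derivCoeff, ih, Nat.descFactorial_succ,
      show n + (k + 1) - k = n + 1 by omega, show n + 1 + k = n + (k + 1) by ring]
    push_cast
    ring

/-! ### Power series of the chain functions -/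

/-- The power series coefficients of `mlTerm`. -/
noncomputable def mlTermCoeff (α : ℝ) (c : ℂ) (k n : ℕ) : ℂ :=
  (n.descFactorial k : ℂ) * c ^ (n - k) * (mlCoeff α n : ℂ)

theorem mlTermCoeff_add (α : ℝ) (c : ℂ) (k n : ℕ) :
    mlTermCoeff α c k (n + k) =
      (derivCoeff^[k] fun n => (mlCoeff α n : ℂ)) n * c ^ n := by
  rw [mlTermCoeff, iterate_derivCoeff, Nat.add_sub_cancel]
  ring

theorem entireCoeff_mlTermCoeff {α : ℝ} (hα0 : 0 < α) (hα1 : α < 1) (c : ℂ) (k : ℕ) :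
    EntireCoeff (mlTermCoeff α c k) := by
  intro R hR
  rw [← summable_nat_add_iff k]
  have h := (((entireCoeff_mlCoeff hα0 hα1).iterate k).summable_norm (c * R)).mul_left (R ^ k)
  refine h.congr fun n => ?_
  rw [mlTermCoeff_add, mul_pow, ← mul_assoc, norm_mul (_ * _), norm_pow (R : ℂ),
    Complex.norm_real, Real.norm_of_nonneg hR.le]
  ring

theorem mlTerm_eq_tsum {α : ℝ} (hα0 : 0 < α) (hα1 : α < 1) (c : ℂ) (k : ℕ) (t : ℝ) :
    mlTerm α c k t = ∑' n, mlTermCoeff α c k n * (t : ℂ) ^ n := by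
  have hE : mittagLefflerL α = fun w => ∑' n, (mlCoeff α n : ℂ) * w ^ n := by
    ext w
    rw [mittagLefflerL]
    refine tsum_congr fun n => ?_
    rw [mlCoeff, Complex.ofReal_inv, div_eq_inv_mul]
  have hs := ((entireCoeff_mlTermCoeff hα0 hα1 c k).summable_norm t).of_norm
  rw [mlTerm, hE, (entireCoeff_mlCoeff hα0 hα1).iteratedDeriv, ← hs.sum_add_tsum_nat_add k,
    Finset.sum_eq_zero, zero_add, ← tsum_mul_left]
  · refine tsum_congr fun n => ?_
    rw [mlTermCoeff_add]
    ring
  · intro n hn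
    rw [mlTermCoeff, Nat.descFactorial_eq_zero_iff_lt.2 (Finset.mem_range.1 hn)]
    simp

/-- The chain relation on coefficients. For `k = j + 1` it comes from `n + 1 = (n - j) + (j + 1)`;
for `k = 0` the factor `k` kills the term with truncated index. -/
theorem mlTermCoeff_succ (α : ℝ) (c : ℂ) (k n : ℕ) :
    mlTermCoeff α c k (n + 1) =
      lRatio α n * (c * mlTermCoeff α c k n + k * mlTermCoeff α c (k - 1) n) := by
  unfold mlTermCoeff
  rw [mlCoeff_succ]
  push_cast
  cases k with
  | zero => simp; ring
  | succ j =>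
    rw [Nat.succ_descFactorial_succ, Nat.descFactorial_succ, Nat.add_sub_cancel,
      Nat.add_sub_add_right]
    -- The truncated subtractions in the exponents of `c` are genuine only for `n > j`; otherwise a
    -- vanishing falling factorial covers for them.
    rcases lt_trichotomy n j with h | h | h
    · simp [Nat.descFactorial_eq_zero_iff_lt.2 h]
    · subst h
      simp
      ring
    · obtain ⟨d, rfl⟩ := Nat.exists_eq_add_of_lt h
      rw [show j + d + 1 - (j + 1) = d by omega, show j + d + 1 - j = d + 1 by omega]
      push_cast
      ring

theorem continuous_mlTerm {α : ℝ} (hα0 : 0 < α) (hα1 : α < 1) (c : ℂ) (k : ℕ) :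
    Continuous (mlTerm α c k) := by
  rw [funext (mlTerm_eq_tsum hα0 hα1 c k)]
  exact (continuous_iff_continuousAt.2 fun z =>
    ((entireCoeff_mlTermCoeff hα0 hα1 c k).hasDerivAt z).continuousAt).comp
    Complex.continuous_ofReal

theorem mlTerm_apply_zero (α : ℝ) (c : ℂ) (k : ℕ) (hα0 : 0 < α) (hα1 : α < 1) :
    mlTerm α c k 0 = if k = 0 then 1 else 0 := by
  rw [mlTerm_eq_tsum hα0 hα1, tsum_eq_single 0]
  · rcases k with _ | k <;> simp [mlTermCoeff, mlCoeff_zero]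
  · intro n hn
    simp [hn]

/-! ### L-fractional integration of power series -/

theorem intervalIntegrable_lKernel {α : ℝ} (hα0 : 0 < α) (hα1 : α < 1) {t : ℝ} (ht : 0 < t) :
    IntervalIntegrable (fun s => (t - s) ^ (α - 1) * s ^ (1 - α)) volume 0 t := by
  have h := intervalIntegrable_rpow_mul_rpow hα0 (show 0 < 2 - α by linarith) ht
  simpa only [sub_zero, show 2 - α - 1 = 1 - α by ring] using h

/-- The weight `s ^ (1 - α)` completes the fractional gain `α` to one full degree, so ordinary power
series are preserved. -/
theorem integral_lKernel_pow {α : ℝ} (hα0 : 0 < α) (hα1 : α < 1) {t : ℝ} (ht : 0 < t) (n : ℕ) :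
    ∫ s in (0 : ℝ)..t, (t - s) ^ (α - 1) * s ^ (1 - α) * s ^ n =
      Real.Gamma α * Real.Gamma (2 - α) * (lRatio α n * t ^ (n + 1)) := by
  have hn : (0 : ℝ) ≤ n := n.cast_nonneg
  have h := integral_rpow_mul_rpow hα0 (show 0 < n + 2 - α by linarith) ht
  have hG := Real.Gamma_pos_of_pos (show 0 < 2 - α by linarith)
  have hG2 := Real.Gamma_pos_of_pos (show (0 : ℝ) < n + 2 by linarith)
  simp only [sub_zero] at h
  rw [show α + (n + 2 - α) - 1 = ((n + 1 : ℕ) : ℝ) by push_cast; ring, Real.rpow_natCast,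
    show α + (n + 2 - α) = (n : ℝ) + 2 by ring] at h
  have h2 : ∫ s in (0 : ℝ)..t, (t - s) ^ (α - 1) * s ^ (1 - α) * s ^ n =
      ∫ s in (0 : ℝ)..t, (t - s) ^ (α - 1) * s ^ ((n : ℝ) + 2 - α - 1) := by
    rw [intervalIntegral.integral_of_le ht.le, intervalIntegral.integral_of_le ht.le]
    refine setIntegral_congr_fun measurableSet_Ioc fun s hs => ?_
    rw [show (n : ℝ) + 2 - α - 1 = 1 - α + n by ring, Real.rpow_add hs.1, Real.rpow_natCast,
      mul_assoc]
  rw [h2, h, lRatio]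
  field_simp

theorem lIntegral_eq (α : ℝ) (g : ℝ → ℂ) (t : ℝ) :
    lIntegral α g t = ((Real.Gamma α * Real.Gamma (2 - α) : ℝ) : ℂ)⁻¹ *
      ∫ s in (0 : ℝ)..t, (((t - s) ^ (α - 1) * s ^ (1 - α) : ℝ) : ℂ) * g s := by
  rw [lIntegral, rlIntegral, ← intervalIntegral.integral_const_mul,
    ← intervalIntegral.integral_const_mul]
  congr 1
  ext s
  push_cast
  rw [mul_inv]
  ring

theorem lIntegral_zero_right (α : ℝ) (g : ℝ → ℂ) : lIntegral α g 0 = 0 := by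
  simp [lIntegral_eq]

theorem intervalIntegrable_lKernel_mul {α : ℝ} (hα0 : 0 < α) (hα1 : α < 1) {t : ℝ} (ht : 0 < t)
    {g : ℝ → ℂ} (hg : ContinuousOn g (Set.Icc 0 t)) :
    IntervalIntegrable (fun s => (((t - s) ^ (α - 1) * s ^ (1 - α) : ℝ) : ℂ) * g s)
      volume 0 t :=
  (intervalIntegrable_lKernel hα0 hα1 ht).complex_ofReal.mul_continuousOn
    (by rwa [Set.uIcc_of_le ht.le])

theorem lIntegral_add {α : ℝ} (hα0 : 0 < α) (hα1 : α < 1) {t : ℝ} (ht : 0 ≤ t) {f g : ℝ → ℂ}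
    (hf : ContinuousOn f (Set.Icc 0 t)) (hg : ContinuousOn g (Set.Icc 0 t)) :
    lIntegral α (fun s => f s + g s) t = lIntegral α f t + lIntegral α g t := by
  rcases ht.eq_or_lt with rfl | ht
  · simp [lIntegral_zero_right]
  simp only [lIntegral_eq, mul_add]
  rw [intervalIntegral.integral_add (intervalIntegrable_lKernel_mul hα0 hα1 ht hf)
    (intervalIntegrable_lKernel_mul hα0 hα1 ht hg), mul_add]

theorem lIntegral_const_mul (α : ℝ) (a : ℂ) (g : ℝ → ℂ) (t : ℝ) :
    lIntegral α (fun s => a * g s) t = a * lIntegral α g t := by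
  simp only [lIntegral_eq, mul_left_comm _ a]
  rw [intervalIntegral.integral_const_mul]
  ring

theorem hasSum_lIntegral {α : ℝ} (hα0 : 0 < α) (hα1 : α < 1) {b : ℕ → ℂ} (hb : EntireCoeff b)
    {t : ℝ} (ht : 0 < t) :
    HasSum (fun n => lRatio α n * b n * (t : ℂ) ^ (n + 1))
      (lIntegral α (fun s => ∑' n, b n * (s : ℂ) ^ n) t) := by
  have hG1 := Real.Gamma_pos_of_pos hα0
  have hG2 := Real.Gamma_pos_of_pos (show 0 < 2 - α by linarith)
  set G : ℝ := Real.Gamma α * Real.Gamma (2 - α) with hG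
  have hGne : (G : ℂ) ≠ 0 := by
    rw [hG]; exact_mod_cast (mul_pos hG1 hG2).ne'
  set F : ℕ → ℝ → ℂ := fun n s =>
    (((t - s) ^ (α - 1) * s ^ (1 - α) : ℝ) : ℂ) * (b n * (s : ℂ) ^ n) with hF
  have hFi : ∀ n, Integrable (F n) (volume.restrict (Set.Ioc 0 t)) := fun n =>
    (intervalIntegrable_iff_integrableOn_Ioc_of_le ht.le).1
      (intervalIntegrable_lKernel_mul hα0 hα1 ht (by fun_prop))
  have hFn : ∀ n, ∫ s in Set.Ioc 0 t, ‖F n s‖ = ‖b n‖ * (G * (lRatio α n * t ^ (n + 1))) := by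
    intro n
    rw [← integral_lKernel_pow hα0 hα1 ht, intervalIntegral.integral_of_le ht.le,
      ← integral_const_mul]
    refine setIntegral_congr_fun measurableSet_Ioc fun s hs => ?_
    have h1 : 0 ≤ (t - s) ^ (α - 1) * s ^ (1 - α) :=
      mul_nonneg (Real.rpow_nonneg (by linarith [hs.2]) _) (Real.rpow_nonneg hs.1.le _)
    simp only [hF, norm_mul, norm_pow, Complex.norm_real]
    rw [← norm_mul, Real.norm_of_nonneg h1, Real.norm_of_nonneg hs.1.le]
    ring
  have hFv : ∀ n, ∫ s in Set.Ioc 0 t, F n s = b n * (G * (lRatio α n * (t : ℂ) ^ (n + 1))) := by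
    intro n
    have := integral_lKernel_pow hα0 hα1 ht n
    rw [intervalIntegral.integral_of_le ht.le] at this
    rw [show (G * (lRatio α n * (t : ℂ) ^ (n + 1))) =
      ((G * (lRatio α n * t ^ (n + 1)) : ℝ) : ℂ) by push_cast; ring, ← this,
      ← integral_complex_ofReal, ← integral_const_mul]
    refine integral_congr_ae (Filter.Eventually.of_forall fun s => ?_)
    simp only [hF]
    push_cast
    ring
  -- Since `lRatio` is bounded, absolute convergence of the series at radius `t` justifies
  -- exchanging sum and integral.
  have hsum : Summable fun n => ∫ s in Set.Ioc 0 t, ‖F n s‖ := by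
    simp only [hFn]
    refine Summable.of_nonneg_of_le (fun n => ?_) (fun n => ?_)
      ((hb t ht).mul_left (G * ((Real.Gamma (2 - α))⁻¹ * t)))
    · have := lRatio_pos hα1 n
      positivity
    · calc ‖b n‖ * (G * (lRatio α n * t ^ (n + 1)))
          ≤ ‖b n‖ * (G * ((Real.Gamma (2 - α))⁻¹ * t ^ (n + 1))) := by
            gcongr
            exact lRatio_le_const hα0 hα1 n
        _ = _ := by rw [pow_succ]; ring
  have h := (hasSum_integral_of_summable_integral_norm hFi hsum).mul_left (G : ℂ)⁻¹
  simp only [hFv] at h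
  rw [lIntegral_eq, ← hG, intervalIntegral.integral_of_le ht.le]
  convert! h using 1
  · ext n
    field_simp
  · simp only [hF, tsum_mul_left]

/-- The integrated chain relation, compared coefficient by coefficient through `mlTermCoeff_succ`.
-/
theorem mlTerm_eq_add_lIntegral {α : ℝ} (hα0 : 0 < α) (hα1 : α < 1) (c : ℂ) (k : ℕ) {t : ℝ}
    (ht : 0 ≤ t) :
    mlTerm α c k t = mlTerm α c k 0 +
      lIntegral α (fun s => c * mlTerm α c k s + k * mlTerm α c (k - 1) s) t := by
  rcases ht.eq_or_lt with rfl | ht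
  · simp [lIntegral_zero_right]
  have hk := hasSum_lIntegral hα0 hα1 (entireCoeff_mlTermCoeff hα0 hα1 c k) ht
  have hk1 := hasSum_lIntegral hα0 hα1 (entireCoeff_mlTermCoeff hα0 hα1 c (k - 1)) ht
  have h := (hk.mul_left c).add (hk1.mul_left (k : ℂ))
  simp only [← mlTerm_eq_tsum hα0 hα1] at h
  have hc := continuous_mlTerm hα0 hα1 c
  rw [lIntegral_add hα0 hα1 ht.le (by fun_prop) (by fun_prop), lIntegral_const_mul,
    lIntegral_const_mul, ← h.tsum_eq, mlTerm_eq_tsum hα0 hα1,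
    ((entireCoeff_mlTermCoeff hα0 hα1 c k).summable_norm t).of_norm.tsum_eq_zero_add]
  congr 1
  · rw [mlTerm_apply_zero α c k hα0 hα1]
    rcases k with _ | k <;> simp [mlTermCoeff, mlCoeff_zero]
  · refine tsum_congr fun n => ?_
    rw [mlTermCoeff_succ]
    ring

/-! ### Gronwall's lemma with a singular kernel -/

/-- Gronwall's lemma for the weakly singular kernel `(t - s) ^ (α - 1)`, homogeneous case. -/
theorem eq_zero_of_le_integral_rpow {α T C : ℝ} (hα0 : 0 < α) (hT : 0 ≤ T) (hC : 0 ≤ C)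
    {w : ℝ → ℂ} (hw : ContinuousOn w (Set.Icc 0 T))
    (h : ∀ t ∈ Set.Ioc 0 T, ‖w t‖ ≤ C * ∫ s in (0 : ℝ)..t, (t - s) ^ (α - 1) * ‖w s‖)
    (h0 : w 0 = 0) {t : ℝ} (ht : t ∈ Set.Icc 0 T) : w t = 0 := by
  -- Under the weight `exp (-K s)` the kernel has mass at most its Laplace transform `K ^ (-α)
  -- Γ(α)`. For large `K` the bound is a strict contraction of the weighted maximum `M`.
  have hlim : Filter.Tendsto (fun K : ℝ => C * (K ^ (-α) * Real.Gamma α)) Filter.atTop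
      (nhds 0) := by
    have := ((tendsto_rpow_neg_atTop hα0).mul_const (Real.Gamma α)).const_mul C
    simpa using this
  obtain ⟨K, hK1, hK0⟩ := ((hlim.eventually (gt_mem_nhds one_pos)).and
    (Filter.eventually_gt_atTop 0)).exists
  obtain ⟨m, hm, hmax⟩ := isCompact_Icc.exists_isMaxOn (Set.nonempty_Icc.2 hT)
    (show ContinuousOn (fun s => Real.exp (-(K * s)) * ‖w s‖) (Set.Icc 0 T) by fun_prop)
  set M := Real.exp (-(K * m)) * ‖w m‖ with hM
  have hbd : ∀ s ∈ Set.Icc 0 T, ‖w s‖ ≤ Real.exp (K * s) * M := by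
    intro s hs
    have h1 : Real.exp (-(K * s)) * ‖w s‖ ≤ M := hmax hs
    rw [Real.exp_neg, inv_mul_le_iff₀ (Real.exp_pos _)] at h1
    exact h1
  have hM0 : 0 ≤ M := by positivity
  suffices hMz : M ≤ 0 by
    have := hbd t ht
    rw [le_antisymm hMz hM0, mul_zero] at this
    exact norm_le_zero_iff.1 this
  rcases hm.1.eq_or_lt with h | hm0
  · rw [hM, ← h, h0]; simp
  have hker : IntervalIntegrable (fun s => (m - s) ^ (α - 1)) volume 0 m := by
    have := intervalIntegrable_rpow_mul_rpow hα0 one_pos hm0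
    simpa using this
  have hwm : ContinuousOn w (Set.uIcc 0 m) := by
    rw [Set.uIcc_of_le hm0.le]
    exact hw.mono (Set.Icc_subset_Icc_right hm.2)
  have hint : IntegrableOn (fun u : ℝ => u ^ (α - 1) * Real.exp (-(K * u))) (Set.Ioi 0) := by
    refine Integrable.of_integral_ne_zero ?_
    rw [Real.integral_rpow_mul_exp_neg_mul_Ioi hα0 hK0]
    have := Real.Gamma_pos_of_pos hα0
    positivity
  have hI : ∫ s in (0 : ℝ)..m, (m - s) ^ (α - 1) * ‖w s‖ ≤
      Real.exp (K * m) * M * (K ^ (-α) * Real.Gamma α) := by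
    calc ∫ s in (0 : ℝ)..m, (m - s) ^ (α - 1) * ‖w s‖
        ≤ ∫ s in (0 : ℝ)..m, (m - s) ^ (α - 1) * (Real.exp (K * s) * M) := by
          refine intervalIntegral.integral_mono_on hm0.le (hker.mul_continuousOn hwm.norm)
            (hker.mul_continuousOn (by fun_prop)) fun s hs => ?_
          have := Real.rpow_nonneg (sub_nonneg.2 hs.2) (α - 1)
          have := hbd s ⟨hs.1, hs.2.trans hm.2⟩
          gcongr
      _ = Real.exp (K * m) * M *
          ∫ u in (0 : ℝ)..m, u ^ (α - 1) * Real.exp (-(K * u)) := by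
          have hc := intervalIntegral.integral_comp_sub_left
            (fun u => u ^ (α - 1) * (Real.exp (K * (m - u)) * M)) (a := 0) (b := m) m
          simp only [sub_sub_cancel, sub_self, sub_zero] at hc
          rw [hc, ← intervalIntegral.integral_const_mul]
          congr 1
          ext u
          rw [show K * (m - u) = K * m + -(K * u) by ring, Real.exp_add]
          ring
      _ ≤ Real.exp (K * m) * M * (K ^ (-α) * Real.Gamma α) := by
          gcongr
          rw [intervalIntegral.integral_of_le hm0.le]
          have h1 := Real.integral_rpow_mul_exp_neg_mul_Ioi hα0 hK0
          rw [one_div, Real.inv_rpow hK0.le, ← Real.rpow_neg hK0.le] at h1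
          rw [← h1]
          refine setIntegral_mono_set hint ?_ (Set.Ioc_subset_Ioi_self.eventuallyLE)
          filter_upwards [ae_restrict_mem measurableSet_Ioi] with u hu
          have := Real.rpow_nonneg (le_of_lt hu) (α - 1)
          simp only [Pi.zero_apply]
          positivity
  have hfin : M ≤ M * (C * (K ^ (-α) * Real.Gamma α)) := by
    calc M ≤ Real.exp (-(K * m)) * (C * (Real.exp (K * m) * M * (K ^ (-α) * Real.Gamma α))) := by
          rw [hM]
          gcongr
          exact (h m ⟨hm0, hm.2⟩).trans (by gcongr)
      _ = (Real.exp (-(K * m)) * Real.exp (K * m)) * M * (C * (K ^ (-α) * Real.Gamma α)) := by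
          ring
      _ = _ := by rw [← Real.exp_add]; simp
  nlinarith

/-! ### Linearity and uniqueness for the integrated equation -/

/-- Integrated form of `(ᴸD^α - c) X = Y` on `[0, T]` for continuous `X` and `Y`. -/
structure IsLSol (α T : ℝ) (c : ℂ) (X Y : ℝ → ℂ) : Prop where
  cont_left : ContinuousOn X (Set.Icc 0 T)
  cont_right : ContinuousOn Y (Set.Icc 0 T)
  eq_add : ∀ t ∈ Set.Icc 0 T, X t = X 0 + lIntegral α (fun s => c * X s + Y s) t

theorem LShift.isLSol {α T : ℝ} (hα0 : 0 < α) (hα1 : α < 1) (hT : 0 ≤ T) {c : ℂ}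
    {x y : ℝ → ℂ} (h : LShift α T c x y) (hy : ContinuousOn y (Set.Icc 0 T)) :
    IsLSol α T c x y where
  cont_left := by simpa only [Set.uIcc_of_le hT] using h.1.continuousOn
  cont_right := hy
  eq_add _ ht := h.eq_add_lIntegral hα0 hα1 ht

namespace IsLSol

variable {α T : ℝ} {c : ℂ} {X Y X' Y' : ℝ → ℂ}

theorem smul (h : IsLSol α T c X Y) (a : ℂ) : IsLSol α T c (a • X) (a • Y) where
  cont_left := h.cont_left.const_smul a
  cont_right := h.cont_right.const_smul a
  eq_add t ht := by
    have h1 := lIntegral_const_mul α a (fun s => c * X s + Y s) t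
    simp only [Pi.smul_apply, smul_eq_mul]
    rw [h.eq_add t ht, mul_add, ← h1]
    congr 2
    ext s
    ring

theorem add (hα0 : 0 < α) (hα1 : α < 1) (h : IsLSol α T c X Y) (h' : IsLSol α T c X' Y') :
    IsLSol α T c (X + X') (Y + Y') where
  cont_left := h.cont_left.add h'.cont_left
  cont_right := h.cont_right.add h'.cont_right
  eq_add t ht := by
    have hs : Set.Icc 0 t ⊆ Set.Icc 0 T := Set.Icc_subset_Icc_right ht.2
    have h1 := lIntegral_add hα0 hα1 ht.1
      (((continuousOn_const.mul h.cont_left).add h.cont_right).mono hs)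
      (((continuousOn_const.mul h'.cont_left).add h'.cont_right).mono hs) (f := fun s =>
        c * X s + Y s) (g := fun s => c * X' s + Y' s)
    simp only [Pi.add_apply]
    rw [h.eq_add t ht, h'.eq_add t ht, add_add_add_comm, ← h1]
    congr 2
    ext s
    ring

theorem sub (hα0 : 0 < α) (hα1 : α < 1) (h : IsLSol α T c X Y) (h' : IsLSol α T c X' Y') :
    IsLSol α T c (X - X') (Y - Y') := by
  simpa [sub_eq_add_neg] using h.add hα0 hα1 (h'.smul (-1))

theorem change_const (h : IsLSol α T c X Y) (d : ℂ) : IsLSol α T d X ((c - d) • X + Y) where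
  cont_left := h.cont_left
  cont_right := (h.cont_left.const_smul _).add h.cont_right
  eq_add t ht := by
    rw [h.eq_add t ht]
    congr 2
    ext s
    simp only [Pi.add_apply, Pi.smul_apply, smul_eq_mul]
    ring

theorem eq_zero (hα0 : 0 < α) (hα1 : α < 1) (hT : 0 ≤ T) (h : IsLSol α T c X 0) (h0 : X 0 = 0)
    {t : ℝ} (ht : t ∈ Set.Icc 0 T) : X t = 0 := by
  have hG1 := Real.Gamma_pos_of_pos hα0
  have hG2 := Real.Gamma_pos_of_pos (show 0 < 2 - α by linarith)
  have hTr := Real.rpow_nonneg hT (1 - α)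
  refine eq_zero_of_le_integral_rpow hα0 hT
    -- The normalisation of `lIntegral`, times the maximum of the weight `s ^ (1 - α)` on `[0, T]`,
    -- times `‖c‖`.
    (C := (Real.Gamma α * Real.Gamma (2 - α))⁻¹ * (T ^ (1 - α) * ‖c‖)) (by positivity)
    h.cont_left (fun t ht => ?_) h0 ht
  have hker : IntervalIntegrable (fun s => (t - s) ^ (α - 1)) volume 0 t := by
    simpa using intervalIntegrable_rpow_mul_rpow hα0 one_pos ht.1
  have hX : ContinuousOn X (Set.Icc 0 t) := h.cont_left.mono (Set.Icc_subset_Icc_right ht.2)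
  have hcX : ContinuousOn (fun s => c * X s) (Set.Icc 0 t) := continuousOn_const.mul hX
  have he := h.eq_add t ⟨ht.1.le, ht.2⟩
  rw [h0, zero_add, lIntegral_eq] at he
  simp only [Pi.zero_apply, add_zero] at he
  rw [he, norm_mul, norm_inv, Complex.norm_real, Real.norm_of_nonneg (by positivity),
    mul_assoc]
  gcongr
  rw [← intervalIntegral.integral_const_mul]
  refine (intervalIntegral.norm_integral_le_integral_norm ht.1.le).trans ?_
  refine intervalIntegral.integral_mono_on ht.1.le
    (intervalIntegrable_lKernel_mul hα0 hα1 ht.1 hcX).norm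
    ((hker.mul_continuousOn (by rw [Set.uIcc_of_le ht.1.le]; exact hX.norm)).const_mul _)
    fun s hs => ?_
  have h1 := Real.rpow_nonneg (sub_nonneg.2 hs.2) (α - 1)
  have h2 := Real.rpow_nonneg hs.1 (1 - α)
  have h3 : s ^ (1 - α) ≤ T ^ (1 - α) :=
    Real.rpow_le_rpow hs.1 (hs.2.trans ht.2) (by linarith)
  rw [norm_mul, norm_mul, Complex.norm_real, Real.norm_of_nonneg (mul_nonneg h1 h2)]
  calc (t - s) ^ (α - 1) * s ^ (1 - α) * (‖c‖ * ‖X s‖)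
      ≤ (t - s) ^ (α - 1) * T ^ (1 - α) * (‖c‖ * ‖X s‖) := by gcongr
    _ = _ := by ring

end IsLSol

/-! ### Inverting the factors on spans of chains -/

theorem isLSol_mlTerm {α T : ℝ} (hα0 : 0 < α) (hα1 : α < 1) (c : ℂ) (k : ℕ) :
    IsLSol α T c (mlTerm α c k) ((k : ℂ) • mlTerm α c (k - 1)) where
  cont_left := (continuous_mlTerm hα0 hα1 c k).continuousOn
  cont_right := ((continuous_mlTerm hα0 hα1 c (k - 1)).const_smul _).continuousOn
  eq_add _ ht := mlTerm_eq_add_lIntegral hα0 hα1 c k ht.1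

/-- The span of the functions `mlTerm α d k` with `k < m d`. -/
def mlSpan (α : ℝ) (m : ℂ → ℕ) : Submodule ℂ (ℝ → ℂ) :=
  Submodule.span ℂ {f | ∃ d k, k < m d ∧ f = mlTerm α d k}

theorem mlTerm_mem_mlSpan {α : ℝ} {m : ℂ → ℕ} {d : ℂ} {k : ℕ} (h : k < m d) :
    mlTerm α d k ∈ mlSpan α m :=
  Submodule.subset_span ⟨d, k, h, rfl⟩

-- At resonance `d = c` the chain is climbed by one step. Otherwise `(D - c) e_{d,k} = (d - c)
-- e_{d,k} + k e_{d,k-1}` is triangular with nonzero diagonal and is solved by induction on `k`.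
open Classical in
theorem exists_isLSol_mlTerm {α T : ℝ} (hα0 : 0 < α) (hα1 : α < 1) (c d : ℂ) {m : ℂ → ℕ} {k : ℕ}
    (hk : k < m d) :
    ∃ X ∈ mlSpan α (m + Pi.single c 1), IsLSol α T c X (mlTerm α d k) := by
  by_cases hcd : d = c
  · subst hcd
    refine ⟨((k + 1 : ℕ) : ℂ)⁻¹ • mlTerm α d (k + 1),
      Submodule.smul_mem _ _ (mlTerm_mem_mlSpan ?_), ?_⟩
    · simpa using hk
    · have h := (isLSol_mlTerm (T := T) hα0 hα1 d (k + 1)).smul ((k + 1 : ℕ) : ℂ)⁻¹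
      rwa [smul_smul, inv_mul_cancel₀ (Nat.cast_ne_zero.2 k.succ_ne_zero), one_smul] at h
  · have hdc : d - c ≠ 0 := sub_ne_zero.2 hcd
    induction k with
    | zero =>
      have h := ((isLSol_mlTerm (T := T) hα0 hα1 d 0).change_const c).smul (d - c)⁻¹
      refine ⟨(d - c)⁻¹ • mlTerm α d 0, Submodule.smul_mem _ _ (mlTerm_mem_mlSpan ?_), ?_⟩
      · simpa [hcd] using hk
      · simpa [smul_smul, hdc] using h
    | succ k ih =>
      obtain ⟨X, hX, hs⟩ := ih ((Nat.lt_succ_self k).trans hk)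
      have h := (((isLSol_mlTerm (T := T) hα0 hα1 d (k + 1)).change_const c).sub hα0 hα1
        (hs.smul ((k + 1 : ℕ) : ℂ))).smul (d - c)⁻¹
      refine ⟨(d - c)⁻¹ • (mlTerm α d (k + 1) - ((k + 1 : ℕ) : ℂ) • X),
        Submodule.smul_mem _ _ (Submodule.sub_mem _ (mlTerm_mem_mlSpan ?_)
        (Submodule.smul_mem _ _ hX)), ?_⟩
      · simpa [hcd] using hk
      · rw [Nat.add_sub_cancel, add_sub_cancel_right, smul_smul, inv_mul_cancel₀ hdc,
          one_smul] at h
        exact h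

open Classical in
theorem exists_isLSol {α T : ℝ} (hα0 : 0 < α) (hα1 : α < 1) (c : ℂ) {m : ℂ → ℕ} {Y : ℝ → ℂ}
    (hY : Y ∈ mlSpan α m) :
    ∃ X ∈ mlSpan α (m + Pi.single c 1), IsLSol α T c X Y := by
  induction hY using Submodule.span_induction with
  | mem f hf =>
    obtain ⟨d, k, hk, rfl⟩ := hf
    exact exists_isLSol_mlTerm hα0 hα1 c d hk
  | zero =>
    refine ⟨0, Submodule.zero_mem _, continuousOn_const, continuousOn_const, fun t _ => ?_⟩
    simp [lIntegral_eq]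
  | add f g _ _ hf hg =>
    obtain ⟨X, hX, hf⟩ := hf
    obtain ⟨X', hX', hg⟩ := hg
    exact ⟨X + X', Submodule.add_mem _ hX hX', hf.add hα0 hα1 hg⟩
  | smul a f _ hf =>
    obtain ⟨X, hX, hf⟩ := hf
    exact ⟨a • X, Submodule.smul_mem _ _ hX, hf.smul a⟩

open Classical in
theorem LShift.exists_mem_mlSpan {α T : ℝ} (hα0 : 0 < α) (hα1 : α < 1) (hT : 0 ≤ T) {c : ℂ}
    {m : ℂ → ℕ} {x y Y : ℝ → ℂ} (h : LShift α T c x y) (hY : Y ∈ mlSpan α m)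
    (hyY : ∀ t ∈ Set.Icc 0 T, y t = Y t) :
    ∃ X ∈ mlSpan α (m + Pi.single c 1), ∀ t ∈ Set.Icc 0 T, x t = X t := by
  obtain ⟨Z, hZ, hs⟩ := exists_isLSol (T := T) hα0 hα1 c hY
  -- Replacing `y` by `Y` supplies the continuity that `LShift` does not require of its right-hand
  -- side.
  have hx : IsLSol α T c x Y := by
    refine LShift.isLSol hα0 hα1 hT ⟨h.1, ?_⟩ hs.cont_right
    filter_upwards [h.2, ae_restrict_mem measurableSet_Icc] with t h1 ht
    rw [h1, hyY t ht]
  have h1 : IsLSol α T c (mlTerm α c 0) 0 := by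
    simpa using isLSol_mlTerm (T := T) hα0 hα1 c 0
  have h2 := (hx.sub hα0 hα1 hs).sub hα0 hα1 (h1.smul (x 0 - Z 0))
  simp only [sub_self, smul_zero] at h2
  -- The homogeneous solution `mlTerm α c 0` is 1 at 0, so this multiple corrects the initial value
  -- of the particular solution `Z`.
  refine ⟨Z + (x 0 - Z 0) • mlTerm α c 0, Submodule.add_mem _ hZ
    (Submodule.smul_mem _ _ (mlTerm_mem_mlSpan (by simp))), fun t ht => ?_⟩
  have h3 := h2.eq_zero hα0 hα1 hT (by simp [mlTerm_apply_zero α c 0 hα0 hα1]) ht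
  simp only [Pi.sub_apply, sub_sub] at h3
  exact sub_eq_zero.1 h3

open Classical in
theorem LShiftPow.exists_mem_mlSpan {α T : ℝ} (hα0 : 0 < α) (hα1 : α < 1) (hT : 0 ≤ T) {c : ℂ}
    (k : ℕ) {m : ℂ → ℕ} {x y Y : ℝ → ℂ} (h : LShiftPow α T c k x y) (hY : Y ∈ mlSpan α m)
    (hyY : ∀ t ∈ Set.Icc 0 T, y t = Y t) :
    ∃ X ∈ mlSpan α (m + Pi.single c k), ∀ t ∈ Set.Icc 0 T, x t = X t := by
  -- The factor applied last is inverted first, so the right-hand side and its multiplicities change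
  -- along the induction.
  induction k generalizing m y Y with
  | zero =>
    obtain rfl : y = x := h
    exact ⟨Y, by simpa using hY, hyY⟩
  | succ k ih =>
    obtain ⟨z, hz, hzy⟩ := h
    obtain ⟨Z, hZ, hzZ⟩ := hzy.exists_mem_mlSpan hα0 hα1 hT hY hyY
    obtain ⟨X, hX, hxX⟩ := ih hz hZ hzZ
    refine ⟨X, ?_, hxX⟩
    rwa [add_assoc, ← Pi.single_add, add_comm 1 k] at hX

open Classical in
theorem LSeq.exists_mem_mlSpan {α T : ℝ} (hα0 : 0 < α) (hα1 : α < 1) (hT : 0 ≤ T)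
    (L : List (ℂ × ℕ)) {m : ℂ → ℕ} {x y Y : ℝ → ℂ} (h : LSeq α T L x y) (hY : Y ∈ mlSpan α m)
    (hyY : ∀ t ∈ Set.Icc 0 T, y t = Y t) :
    ∃ X ∈ mlSpan α (m + (L.map fun p => Pi.single p.1 p.2).sum),
      ∀ t ∈ Set.Icc 0 T, x t = X t := by
  induction L generalizing m y Y with
  | nil =>
    obtain rfl : y = x := h
    exact ⟨Y, by simpa using hY, hyY⟩
  | cons p L ih =>
    obtain ⟨z, hz, hzy⟩ := h
    obtain ⟨Z, hZ, hzZ⟩ := hzy.exists_mem_mlSpan hα0 hα1 hT _ hY hyY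
    obtain ⟨X, hX, hxX⟩ := ih hz hZ hzZ
    refine ⟨X, ?_, hxX⟩
    rwa [List.map_cons, List.sum_cons, ← add_assoc]

end LFrac

theorem mainTheorem5 (α : ℝ) (hα0 : 0 < α) (hα1 : α < 1) (T : ℝ) (hT : 0 < T)
    (r : ℕ) (lam : Fin r → ℂ) (hlam : Function.Injective lam)
    (n : Fin r → ℕ) (hn : ∀ l, 1 ≤ n l)
    (J : ℕ) (β : ℕ → ℂ) (μ : ℂ) (x : ℝ → ℂ)
    (hx : LFrac.LSeq α T (List.ofFn fun l => (lam l, n l)) x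
      (fun t => ∑ j ∈ Finset.range (J + 1), β j * LFrac.mlTerm α μ j t)) :
    ((∀ l, μ ≠ lam l) →
      ∃ y ∈ Submodule.span ℂ
          ((⋃ l, LFrac.block α (lam l) (n l)) ∪ {f | ∃ j ≤ J, f = LFrac.mlTerm α μ j}),
        ∀ t ∈ Set.Icc 0 T, x t = y t) ∧
    (∀ l₀, μ = lam l₀ →
      ∃ y ∈ Submodule.span ℂ
          ((⋃ l, ⋃ (_ : l ≠ l₀), LFrac.block α (lam l) (n l)) ∪
            {f | ∃ k ≤ J + n l₀, f = LFrac.mlTerm α (lam l₀) k}),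
        ∀ t ∈ Set.Icc 0 T, x t = y t) := by
  classical
  have hY : (∑ j ∈ Finset.range (J + 1), β j • LFrac.mlTerm α μ j) ∈
      LFrac.mlSpan α (Pi.single μ (J + 1)) :=
    Submodule.sum_mem _ fun j hj => Submodule.smul_mem _ _
      (LFrac.mlTerm_mem_mlSpan (by simpa using hj))
  obtain ⟨X, hX, hxX⟩ := LFrac.LSeq.exists_mem_mlSpan hα0 hα1 hT.le _ hx hY (by simp)
  -- Total multiplicities: the forcing term contributes `J + 1` at `μ`, the operator `n l` at `lam
  -- l`. In the resonant case they add at `lam l₀`, whence `k ≤ J + n l₀`.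
  set m : ℂ → ℕ := Pi.single μ (J + 1) +
    ((List.ofFn fun l => (lam l, n l)).map fun p => Pi.single p.1 p.2).sum with hm
  have hmd : ∀ d, m d = (if d = μ then J + 1 else 0) + ∑ l, if d = lam l then n l else 0 := by
    intro d
    simp [hm, List.map_ofFn, List.sum_ofFn, Pi.single_apply]
  have hml : ∀ l, ∑ l', (if lam l = lam l' then n l' else 0) = n l := by
    intro l
    simp [hlam.eq_iff]
  have hmne : ∀ d, (∀ l, d ≠ lam l) → ∑ l, (if d = lam l then n l else 0) = 0 :=
    fun d hd => Finset.sum_eq_zero fun l _ => if_neg (hd l)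
  refine ⟨fun hμ => ⟨X, Submodule.span_mono ?_ hX, hxX⟩,
    fun l₀ hl₀ => ⟨X, Submodule.span_mono ?_ hX, hxX⟩⟩
  · rintro f ⟨d, k, hk, rfl⟩
    rw [hmd] at hk
    by_cases hd : ∃ l, d = lam l
    · obtain ⟨l, rfl⟩ := hd
      rw [if_neg (hμ l).symm, hml, zero_add] at hk
      exact Or.inl (Set.mem_iUnion.2 ⟨l, k, hk, rfl⟩)
    · push Not at hd
      rw [hmne d hd, add_zero] at hk
      split_ifs at hk with h
      · subst h
        exact Or.inr ⟨k, Nat.lt_succ_iff.1 hk, rfl⟩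
      · exact absurd hk k.not_lt_zero
  · subst hl₀
    rintro f ⟨d, k, hk, rfl⟩
    rw [hmd] at hk
    by_cases hd : ∃ l, d = lam l
    · obtain ⟨l, rfl⟩ := hd
      rw [hml] at hk
      by_cases h : l = l₀
      · subst h
        rw [if_pos rfl] at hk
        exact Or.inr ⟨k, by omega, rfl⟩
      · rw [if_neg (hlam.ne h), zero_add] at hk
        exact Or.inl (Set.mem_iUnion₂.2 ⟨l, h, k, hk, rfl⟩)
    · push Not at hd
      rw [hmne d hd, if_neg (hd l₀)] at hk
      exact absurd hk k.not_lt_zero
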